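/- For $n\ge 2$ let $S_n$ be the $n$-dimensional star graph: its vertices are the permutations $p_1p_2\cdots p_n$ of $\{1,\dots,n\}$, and two vertices are adjacent if and only if one is obtained from the other by exchanging the symbol in the first position with the symbol in the $i$-th position for some $i\in\{2,\dots,n\}$. For a finite connected graph $G$ and an integer $k\ge 0$, a set $S\subset V(G)$ (respectively $F\subset E(G)$) is a $k$-vertex-cut (respectively $k$-edge-cut) if $G-S$ (respectively $G-F$) is disconnected and has minimum degree at least $k$. The $k$-super connectivity $\kappa_s^{(k)}(G)$ (respectively the $k$-super edge-connectivity $\lambda_s^{(k)}(G)$) is the minimum cardinality of a $k$-vertex-cut (respectively $k$-edge-cut) of $G$, and it is $\infty$ if there is none; a complete graph $K_m$ has no vertex-cut, and as usual one sets $\kappa_s^{(0)}(K_m)=\kappa(K_m)=m-1$. Theorem. For all integers $n$ and $k$ with $0\le k\le n-2$, $$\kappa_s^{(k)}(S_n)=\lambda_s^{(k)}(S_n)=(k+1)!\,(n-k-1).$$ In particular, $k$-edge-cuts of $S_n$ exist, and, when $n\ge 3$, so do $k$-vertex-cuts. -/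

import Mathlib

/-- The `n`-dimensional star graph. A vertex `p : Equiv.Perm (Fin n)` is the permutation
`p₁ p₂ … pₙ`, read as the map from positions to symbols, the first position being the one of
value `0`. Two vertices are adjacent iff one arises from the other by exchanging the symbol in
the first position with the symbol in another position. -/
def starGraph (n : ℕ) : SimpleGraph (Equiv.Perm (Fin n)) where
  Adj p q := ∃ i j : Fin n, i.val = 0 ∧ j ≠ i ∧ q = p * Equiv.swap i j
  symm := ⟨by
    rintro p q ⟨i, j, hi, hj, rfl⟩
    exact ⟨i, j, hi, hj, by simp [mul_assoc]⟩⟩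
  loopless := ⟨by
    rintro p ⟨i, j, -, hj, h⟩
    have h1 : Equiv.swap i j = 1 := by simpa using h
    exact hj (Equiv.swap_eq_one_iff.mp h1).symm⟩

open Classical in
/-- `S` is a `k`-vertex-cut of `G`: the graph `G - S` is disconnected and has minimum degree at
least `k`. (`Preconnected` says that any two vertices are joined by a walk, so a graph that is not
`Preconnected` has at least two vertices.) -/
def IsKVertexCut {V : Type*} [Fintype V] (G : SimpleGraph V) (k : ℕ) (S : Finset V) : Prop :=
  ¬ (G.induce ((S : Set V)ᶜ)).Preconnected ∧ k ≤ (G.induce ((S : Set V)ᶜ)).minDegree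

open Classical in
/-- `F` is a `k`-edge-cut of `G`: it is a set of edges of `G`, and the graph `G - F` is
disconnected and has minimum degree at least `k`. -/
def IsKEdgeCut {V : Type*} [Fintype V] (G : SimpleGraph V) (k : ℕ) (F : Finset (Sym2 V)) : Prop :=
  (F : Set (Sym2 V)) ⊆ G.edgeSet ∧
    ¬ (G.deleteEdges (F : Set (Sym2 V))).Preconnected ∧
    k ≤ (G.deleteEdges (F : Set (Sym2 V))).minDegree

open Classical in
/-- The `k`-super connectivity: the minimum cardinality of a `k`-vertex-cut, and `⊤` if there is
none. A complete graph has no vertex-cut at all; for `k = 0` its connectivity is, by the usual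
convention, the number of its vertices minus one. -/
noncomputable def superConnectivity {V : Type*} [Fintype V] (G : SimpleGraph V) (k : ℕ) : ℕ∞ :=
  if k = 0 ∧ G = ⊤ then ((Fintype.card V - 1 : ℕ) : ℕ∞)
  else ⨅ (S : Finset V) (_ : IsKVertexCut G k S), (S.card : ℕ∞)

/-- The `k`-super edge-connectivity: the minimum cardinality of a `k`-edge-cut, and `⊤` if there
is none. -/
noncomputable def superEdgeConnectivity {V : Type*} [Fintype V] (G : SimpleGraph V) (k : ℕ) : ℕ∞ :=
  ⨅ (F : Finset (Sym2 V)) (_ : IsKEdgeCut G k F), (F.card : ℕ∞)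

/-!
The lower bound for vertex cuts and for edge cuts is one statement, `factorial_mul_le_cost`: for two
disjoint nonempty sets `X`, `Y` of minimum degree at least `k` in the star graph of dimension `m`,
the number of vertices outside `X ∪ Y` plus the number of edges from `X` to `Y` is at least
`(k + 1)! (m - k - 1)`. It is proved by induction on `k`. A position `i` other than the first
splits the star graph by the symbol at `i` into `m` classes, each a star graph of dimension `m - 1`
joined to any other one by `(m - 2)!` independent edges. In a class that meets both sides, the sides
have minimum degree at least `k - 1`, so for `k ≥ 1` the class costs at least
`f = k! (m - k - 1) ≤ (m - 2)!`, and the goal is a total cost of `(k + 1) f`. This is reached if at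
least `k + 1` classes are common to both sides, if some class meets neither side, or if each side
has a class of its own, because of the independent edges. Otherwise one side has no class of its
own, hence at most `k` classes, and the other side meets all classes.

By `exists_card_image` each side meets at least `k + 1` classes for some choice of `i`. So in the
remaining case there are a position `i` where `Y` has at most `k` symbols, all of them common, and
another position `i'` where `X` has at most `k` symbols. The permutations avoiding the symbols of
`Y` at `i` and those of `X` at `i'` lie outside `X ∪ Y`, and there are at least `(m - 2)!` of them
in each class that `Y` does not meet (`mul_add_mul_le_cost`). Every one of the `m` classes thus
costs at least `f`. The case `k = 0` (`card_sub_one_le_cost`) is an induction on `m` over the same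
classes.

The bound is attained by the subgraph of the permutations that fix all positions after the first
`k + 1`: its neighbourhood is a vertex cut and its edge boundary is an edge cut. A vertex outside
loses at most one neighbour, which keeps the degree at least `n - 2 ≥ k`.
-/

namespace StarCut
open Finset Equiv

variable {α : Type*} [Fintype α] [DecidableEq α]

/-! ### Cosets of the group of permutations of a set of positions -/

/-- The permutations that agree with `s` at all positions outside `P`. For `o ∈ P` and the
directions `j ∈ P`, `j ≠ o`, they span a copy of the star graph of dimension `#P`, so that
passing to a smaller star graph needs no relabelling of positions or symbols. -/
def coset (P : Finset α) (s : Perm α) : Finset (Perm α) := {p | ∀ a ∉ P, p a = s a}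

/-- Every `x ∈ X` has at least `k` neighbours in `X` along the directions `j ∈ P`, `j ≠ o`. Here
`o` plays the role of the first position, and the neighbour of `x` in direction `j` is
`x * swap o j`. -/
def MinDegree (o : α) (P : Finset α) (k : ℕ) (X : Finset (Perm α)) : Prop :=
  ∀ x ∈ X, k ≤ #{j ∈ P.erase o | x * swap o j ∈ X}

/-- The cost of separating `X` from `Y` within `C`: the number of vertices of `C` outside `X ∪ Y`
plus the number of edges from `X` to `Y` in the directions of `P`, an edge being recorded as its
end in `X` together with its direction. Vertex cuts have no edges from `X` to `Y`, and edge cuts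
leave no vertices outside `X ∪ Y`. -/
def cost (o : α) (P : Finset α) (C X Y : Finset (Perm α)) : ℕ :=
  #(C \ (X ∪ Y)) + #{q ∈ X ×ˢ P.erase o | q.1 * swap o q.2 ∈ Y}

lemma mem_coset {P : Finset α} {s p : Perm α} : p ∈ coset P s ↔ ∀ a ∉ P, p a = s a := by
  simp [coset]

lemma self_mem_coset (P : Finset α) (s : Perm α) : s ∈ coset P s := by simp [mem_coset]

lemma coset_eq {P : Finset α} {s p : Perm α} (h : p ∈ coset P s) : coset P s = coset P p := by
  rw [mem_coset] at h
  ext q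
  simp only [mem_coset]
  exact forall₂_congr fun a ha => by rw [h a ha]

lemma mul_swap_mem_coset {P : Finset α} {s p : Perm α} (h : p ∈ coset P s) {a b : α}
    (ha : a ∈ P) (hb : b ∈ P) : p * swap a b ∈ coset P s := by
  rw [mem_coset] at h ⊢
  intro c hc
  rw [Perm.mul_apply, swap_apply_of_ne_of_ne (by grind) (by grind), h c hc]

lemma apply_mem_image {P : Finset α} {s p : Perm α} (h : p ∈ coset P s) {i : α} (hi : i ∈ P) :
    p i ∈ P.image s := by
  rw [mem_coset] at h
  rw [mem_image]
  refine ⟨s.symm (p i), ?_, by simp⟩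
  by_contra hc
  have h1 := h _ hc
  rw [apply_symm_apply] at h1
  exact hc (by rw [p.injective h1]; exact hi)

lemma symm_apply_mem {P : Finset α} {s p : Perm α} (h : p ∈ coset P s) {b : α}
    (hb : b ∈ P.image s) : p.symm b ∈ P := by
  rw [mem_coset] at h
  obtain ⟨c, hc, rfl⟩ := mem_image.1 hb
  by_contra hn
  have h1 := h _ hn
  rw [apply_symm_apply] at h1
  exact hn (by rw [← s.injective h1]; exact hc)

lemma card_coset (P : Finset α) (s : Perm α) : #(coset P s) = (#P).factorial := by
  have h1 : #(coset P s) = #(coset P (1 : Perm α)) := by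
    refine card_bij (fun p _ => s⁻¹ * p) ?_ ?_ ?_
    · intro p hp
      rw [mem_coset] at hp ⊢
      intro a ha
      simp [hp a ha]
    · intro p _ q _ h
      simpa using h
    · intro p hp
      rw [mem_coset] at hp
      refine ⟨s * p, ?_, by simp⟩
      rw [mem_coset]
      intro a ha
      simp [hp a ha]
  rw [h1]
  have h2 := Fintype.card_congr (Perm.subtypeEquivSubtypePerm (fun a => a ∈ P))
  rw [Fintype.card_perm, Fintype.card_coe, Fintype.card_subtype] at h2
  rw [h2]
  rfl

lemma filter_coset {P : Finset α} {s p : Perm α} (h : p ∈ coset P s) {i : α} :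
    {q ∈ coset P s | q i = p i} = coset (P.erase i) p := by
  rw [coset_eq h]
  ext q
  simp only [mem_filter, mem_coset, mem_erase]
  grind

lemma exists_apply_eq {P : Finset α} (s : Perm α) {i a : α} (hi : i ∈ P) (ha : a ∈ P.image s) :
    ∃ p ∈ coset P s, p i = a :=
  ⟨s * swap i (s.symm a),
    mul_swap_mem_coset (self_mem_coset P s) hi (symm_apply_mem (self_mem_coset P s) ha), by simp⟩

lemma card_filter_apply {P : Finset α} (s : Perm α) {i a : α} (hi : i ∈ P)
    (ha : a ∈ P.image s) : #{p ∈ coset P s | p i = a} = (#P - 1).factorial := by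
  obtain ⟨p, hp, rfl⟩ := exists_apply_eq s hi ha
  rw [filter_coset hp, card_coset, card_erase_of_mem hi]

lemma card_filter_apply_apply {P : Finset α} (s : Perm α) {i i' a b : α} (hi : i ∈ P)
    (hi' : i' ∈ P) (hne : i' ≠ i) (ha : a ∈ P.image s) (hb : b ∈ P.image s) (hab : b ≠ a) :
    #{p ∈ coset P s | p i = a ∧ p i' = b} = (#P - 2).factorial := by
  obtain ⟨p, hp, rfl⟩ := exists_apply_eq s hi ha
  rw [← filter_filter, filter_coset hp, card_filter_apply p (mem_erase.2 ⟨hne, hi'⟩),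
    card_erase_of_mem hi, Nat.sub_sub]
  have h1 := symm_apply_mem hp hb
  refine mem_image.2 ⟨p.symm b, mem_erase.2 ⟨?_, h1⟩, by simp⟩
  rintro h2
  exact hab (by rw [← h2]; simp)

/-- Among the permutations of a coset, those with symbols from `A` and `B` at two given positions
are counted by the pairs of distinct symbols. -/
lemma card_filter_mem_mem {P : Finset α} (s : Perm α) {i i' : α} (hi : i ∈ P) (hi' : i' ∈ P)
    (hne : i' ≠ i) {A B : Finset α} (hA : A ⊆ P.image s) (hB : B ⊆ P.image s) :
    #{p ∈ coset P s | p i ∈ A ∧ p i' ∈ B} =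
      #{q ∈ A ×ˢ B | q.2 ≠ q.1} * (#P - 2).factorial := by
  rw [card_eq_sum_card_fiberwise (f := fun p : Perm α => (p i, p i'))
    (t := {q ∈ A ×ˢ B | q.2 ≠ q.1})]
  · rw [sum_const_nat]
    rintro ⟨a, b⟩ hq
    simp only [mem_filter, mem_product] at hq
    rw [← card_filter_apply_apply s hi hi' hne (hA hq.1.1) (hB hq.1.2) hq.2]
    congr 1
    ext p
    simp only [mem_filter, Prod.mk.injEq]
    grind
  · intro p hp
    simp only [coe_filter, Set.mem_ofPred_eq, mem_product] at hp ⊢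
    exact ⟨hp.2, fun h => hne (p.injective h)⟩

omit [Fintype α] in
lemma mul_swap_apply_of_ne {o i j : α} (p : Perm α) (hio : i ≠ o) (hij : j ≠ i) :
    (p * swap o j) i = p i := by
  rw [Perm.mul_apply, swap_apply_of_ne_of_ne hio hij.symm]

/-- Fixing the symbol at one position costs at most one direction. -/
lemma MinDegree.filter {o : α} {P : Finset α} {k : ℕ} {X : Finset (Perm α)}
    (h : MinDegree o P (k + 1) X) {i : α} (hi : i ≠ o) (a : α) :
    MinDegree o (P.erase i) k {x ∈ X | x i = a} := by
  intro x hx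
  rw [mem_filter] at hx
  have h1 : {j ∈ P.erase o | x * swap o j ∈ X}.erase i ⊆
      {j ∈ (P.erase i).erase o | x * swap o j ∈ {x ∈ X | x i = a}} := by
    intro j hj
    simp only [mem_erase, mem_filter] at hj ⊢
    exact ⟨⟨hj.2.1.1, hj.1, hj.2.1.2⟩, hj.2.2, by rw [mul_swap_apply_of_ne x hi hj.1, hx.2]⟩
  have h2 := card_le_card h1
  have h3 := pred_card_le_card_erase (s := {j ∈ P.erase o | x * swap o j ∈ X}) (a := i)
  have h4 := h x hx.1
  omega

lemma cost_comm (o : α) (P : Finset α) (C X Y : Finset (Perm α)) :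
    cost o P C X Y = cost o P C Y X := by
  unfold cost
  rw [union_comm X Y]
  congr 1
  refine card_nbij' (fun q => (q.1 * swap o q.2, q.2)) (fun q => (q.1 * swap o q.2, q.2))
    ?_ ?_ ?_ ?_ <;> intro q hq <;>
    simp only [coe_filter, mem_product, Set.mem_ofPred_eq] at hq ⊢ <;>
    simp [mul_assoc, hq]

/-- The cost is the sum of the costs of the classes given by the symbol at position `i`, plus the
number of edges in direction `i`, which are the only ones that join different classes. -/
lemma cost_eq {o i : α} {P : Finset α} {C X Y : Finset (Perm α)} (hi : i ∈ P.erase o)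
    {T : Finset α} (hC : ∀ p ∈ C, p i ∈ T) (hX : X ⊆ C) :
    cost o P C X Y = #{x ∈ X | x * swap o i ∈ Y} +
      ∑ a ∈ T, cost o (P.erase i) {p ∈ C | p i = a} {p ∈ X | p i = a} {p ∈ Y | p i = a} := by
  obtain ⟨hio, hiP⟩ := mem_erase.1 hi
  have h1 : #(C \ (X ∪ Y)) =
      ∑ a ∈ T, #({p ∈ C | p i = a} \ ({p ∈ X | p i = a} ∪ {p ∈ Y | p i = a})) := by
    rw [card_eq_sum_card_fiberwise (f := fun p : Perm α => p i) (t := T)]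
    · refine sum_congr rfl fun a _ => ?_
      congr 1
      ext p
      simp only [mem_filter, mem_sdiff, mem_union]
      tauto
    · intro p hp
      exact hC p (mem_sdiff.1 hp).1
  have h2 : #{q ∈ {q ∈ X ×ˢ P.erase o | q.1 * swap o q.2 ∈ Y} | q.2 ≠ i} =
      ∑ a ∈ T, #{q ∈ {p ∈ X | p i = a} ×ˢ (P.erase i).erase o |
        q.1 * swap o q.2 ∈ {p ∈ Y | p i = a}} := by
    rw [card_eq_sum_card_fiberwise (f := fun q : Perm α × α => q.1 i) (t := T)]
    · refine sum_congr rfl fun a _ => ?_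
      congr 1
      ext ⟨p, j⟩
      simp only [mem_filter, mem_product, mem_erase]
      constructor
      · rintro ⟨⟨⟨⟨h1, h2⟩, h3⟩, h4⟩, h5⟩
        refine ⟨⟨⟨h1, h5⟩, h2.1, h4, h2.2⟩, h3, ?_⟩
        rw [mul_swap_apply_of_ne p hio h4, h5]
      · rintro ⟨⟨⟨h1, h5⟩, h2, h4, h6⟩, h3, -⟩
        exact ⟨⟨⟨⟨h1, h2, h6⟩, h3⟩, h4⟩, h5⟩
    · intro q hq
      simp only [coe_filter, mem_filter, mem_product, Set.mem_ofPred_eq] at hq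
      exact hC _ (hX hq.1.1.1)
  have h3 : #{q ∈ {q ∈ X ×ˢ P.erase o | q.1 * swap o q.2 ∈ Y} | q.2 = i} =
      #{x ∈ X | x * swap o i ∈ Y} := by
    refine card_nbij' (fun q => q.1) (fun x => (x, i)) ?_ ?_ ?_ ?_ <;> intro q hq <;>
      simp only [coe_filter, mem_filter, mem_product, Set.mem_ofPred_eq] at hq ⊢
    · exact ⟨hq.1.1.1, hq.2 ▸ hq.1.2⟩
    · exact ⟨⟨⟨hq.1, hi⟩, hq.2⟩, trivial⟩
    · exact Prod.ext rfl hq.2.symm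
  unfold cost
  rw [sum_add_distrib, ← h1, ← h2, ← h3,
    ← card_filter_add_card_filter_not (s := {q ∈ X ×ˢ P.erase o | q.1 * swap o q.2 ∈ Y})
      (fun q => q.2 = i)]
  ring

/-! ### Symbols at a position -/

/-- The symbols at position `i` in `X`. -/
abbrev symbols (X : Finset (Perm α)) (i : α) : Finset α := X.image fun x => x i

/-- A set of minimum degree at least `k + 1` shows at least `k + 2` symbols at some position other
than `o`. If every symbol occurs at `o`, then each one also occurs at `k + 1` other positions, and
the bound follows by double counting. A symbol that never occurs at `o` cannot move, and its
position can be removed from `P`. -/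
lemma exists_card_image {o : α} {k : ℕ} (P : Finset α) : ∀ {s : Perm α} {X : Finset (Perm α)},
    o ∈ P → X ⊆ coset P s → X.Nonempty → MinDegree o P (k + 1) X →
      ∃ i ∈ P.erase o, k + 2 ≤ #(symbols X i) := by
  induction P using Finset.strongInduction with
  | H P ih =>
  intro s X ho hX hne hdeg
  by_cases hall : ∀ a ∈ P.image s, ∃ x ∈ X, x o = a
  · by_contra! hlt
    have h1 : ∑ i ∈ P.erase o, #(symbols X i) ≤ #(P.erase o) * (k + 1) := by
      refine (sum_le_card_nsmul _ _ (k + 1) fun i hi => ?_).trans_eq (by simp)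
      have := hlt i hi
      omega
    have h2 : #(P.image s) * (k + 1) ≤
        ∑ a ∈ P.image s, #{i ∈ P.erase o | a ∈ symbols X i} := by
      refine le_trans (by simp) (card_nsmul_le_sum _ _ (k + 1) fun a ha => ?_)
      obtain ⟨x, hx, rfl⟩ := hall a ha
      refine (hdeg x hx).trans (card_le_card fun j hj => ?_)
      simp only [mem_filter, mem_image] at hj ⊢
      exact ⟨hj.1, _, hj.2, by simp⟩
    have h3 : ∑ a ∈ P.image s, #{i ∈ P.erase o | a ∈ symbols X i} =
        ∑ i ∈ P.erase o, #{a ∈ P.image s | a ∈ symbols X i} := by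
      simp only [card_filter]
      exact sum_comm
    have h4 : ∑ i ∈ P.erase o, #{a ∈ P.image s | a ∈ symbols X i} ≤
        ∑ i ∈ P.erase o, #(symbols X i) :=
      sum_le_sum fun i _ => card_le_card fun a ha => (mem_filter.1 ha).2
    rw [card_image_of_injective _ s.injective] at h2
    have h5 := card_erase_add_one ho
    rw [← h5] at h2
    nlinarith
  · push Not at hall
    obtain ⟨a, ha, hao⟩ := hall
    obtain ⟨x, hx⟩ := hne
    have hiP : x.symm a ∈ P := symm_apply_mem (hX hx) ha
    have hio : x.symm a ≠ o := fun h => hao x hx (by rw [← h]; simp)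
    have hxa : x (x.symm a) = a := by simp
    set i := x.symm a
    obtain ⟨j, hj, hcard⟩ := ih (P.erase i) (erase_ssubset hiP) (s := x)
      (X := {y ∈ X | y i = a}) (mem_erase.2 ⟨hio.symm, ho⟩)
      (by
        rw [← filter_coset (hX hx), hxa]
        exact filter_subset_filter _ hX)
      ⟨x, mem_filter.2 ⟨hx, hxa⟩⟩
      (by
        intro y hy
        rw [mem_filter] at hy
        refine (hdeg y hy.1).trans (card_le_card fun j hj => ?_)
        simp only [mem_filter, mem_erase] at hj ⊢
        have hji : j ≠ i := by
          rintro rfl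
          exact hao _ hj.2 (by simp [hy.2])
        exact ⟨⟨hj.1.1, hji, hj.1.2⟩, hj.2, by rw [mul_swap_apply_of_ne y hio hji, hy.2]⟩)
    simp only [mem_erase] at hj
    exact ⟨j, mem_erase.2 ⟨hj.1, hj.2.2⟩,
      hcard.trans (card_le_card (image_subset_image (filter_subset _ _)))⟩

/-! ### The cost of the classes given by the symbol at a position -/

/-- The part of the cost that lies in the class of the permutations with symbol `a` at `i`. -/
def classCost (o : α) (P : Finset α) (C X Y : Finset (Perm α)) (i a : α) : ℕ :=
  cost o (P.erase i) {p ∈ C | p i = a} {p ∈ X | p i = a} {p ∈ Y | p i = a}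

lemma card_missing_le_classCost {o : α} {P : Finset α} {C X Y : Finset (Perm α)} {i a : α} :
    #{p ∈ C \ (X ∪ Y) | p i = a} ≤ classCost o P C X Y i a := by
  refine le_trans (card_le_card fun p hp => ?_) (Nat.le_add_right _ _)
  simp only [mem_filter, mem_sdiff, mem_union] at hp ⊢
  tauto

lemma sum_classCost_le_cost {o i : α} {P : Finset α} {s : Perm α} {X Y : Finset (Perm α)}
    (hi : i ∈ P.erase o) (hX : X ⊆ coset P s) {A : Finset α} (hA : A ⊆ P.image s) :
    ∑ a ∈ A, classCost o P (coset P s) X Y i a ≤ cost o P (coset P s) X Y := by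
  rw [cost_eq (Y := Y) hi (fun p hp => apply_mem_image hp (mem_of_mem_erase hi)) hX]
  exact le_trans (sum_le_sum_of_subset hA) (Nat.le_add_left _ _)

/-- A class that meets neither `X` nor `Y` contributes all its vertices to the cost. -/
lemma factorial_le_cost {o i a : α} {P : Finset α} {s : Perm α} {X Y : Finset (Perm α)}
    (hi : i ∈ P.erase o) (hX : X ⊆ coset P s) (ha : a ∈ P.image s) (haX : a ∉ symbols X i)
    (haY : a ∉ symbols Y i) : (#P - 1).factorial ≤ cost o P (coset P s) X Y := by
  have h := sum_classCost_le_cost (Y := Y) hi hX (singleton_subset_iff.2 ha)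
  rw [sum_singleton] at h
  refine le_trans ?_ h
  rw [← card_filter_apply s (mem_of_mem_erase hi) ha]
  refine le_trans (card_le_card fun p hp => ?_) card_missing_le_classCost
  simp only [mem_filter, mem_sdiff, mem_union, mem_image, not_exists, not_and] at *
  exact ⟨⟨hp.1, fun h => h.elim (fun h => haX p h hp.2) (fun h => haY p h hp.2)⟩, hp.2⟩

/-- Let `A` and `B` be disjoint sets of symbols that do not occur at position `i` in `Y` and in `X`,
respectively. The edges in direction `i` between the classes of `A` and those of `B` form a
matching. Each of them has an end outside `X ∪ Y` or leads from `X` to `Y`, so each contributes to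
the cost, in addition to what the classes common to `X` and `Y` contribute. -/
lemma mul_add_le_cost {o i : α} {P : Finset α} {s : Perm α} {X Y : Finset (Perm α)} {f : ℕ}
    (hi : i ∈ P.erase o) (ho : o ∈ P) (hX : X ⊆ coset P s)
    (hf : ∀ a ∈ symbols X i ∩ symbols Y i, f ≤ classCost o P (coset P s) X Y i a)
    {A B : Finset α} (hA : A ⊆ P.image s) (hB : B ⊆ P.image s)
    (hAY : Disjoint A (symbols Y i)) (hBX : Disjoint B (symbols X i)) (hAB : Disjoint A B) :
    #(symbols X i ∩ symbols Y i) * f + #A * #B * (#P - 2).factorial ≤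
      cost o P (coset P s) X Y := by
  obtain ⟨hio, hiP⟩ := mem_erase.1 hi
  have hC : ∀ p ∈ coset P s, p i ∈ P.image s := fun p hp => apply_mem_image hp hiP
  have h1 : #{p ∈ coset P s | p i ∈ A ∧ p o ∈ B} = #A * #B * (#P - 2).factorial := by
    rw [card_filter_mem_mem s hiP ho hio.symm hA hB, filter_true_of_mem, card_product]
    rintro ⟨a, b⟩ h
    rw [mem_product] at h
    exact (disjoint_left.1 hAB.symm h.2 <| · ▸ h.1)
  set M := coset P s \ (X ∪ Y) with hM
  have h2 : #{p ∈ coset P s | p i ∈ A ∧ p o ∈ B} ≤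
      #{p ∈ M | p i ∈ A ∪ B} + #{x ∈ X | x * swap o i ∈ Y} := by
    rw [← card_disjSum]
    refine card_le_card_of_injOn (fun p => if p ∈ M then .inl p else
      if p * swap o i ∈ M then .inl (p * swap o i) else .inr p) ?_ ?_
    · intro p hp
      simp only [coe_filter, Set.mem_ofPred_eq] at hp
      have hq := mul_swap_mem_coset hp.1 ho hiP
      have hqi : (p * swap o i) i = p o := by simp
      have hpY : p ∉ Y := fun h => disjoint_left.1 hAY hp.2.1 (mem_image_of_mem _ h)
      have hqX : p * swap o i ∉ X := fun h =>
        disjoint_left.1 hBX hp.2.2 (mem_image.2 ⟨_, h, hqi⟩)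
      dsimp only
      split_ifs with h1 h2
      · simp [h1, hp.2.1]
      · simp [h2, hp.2.2]
      · simp only [hM, mem_sdiff, mem_union] at h1 h2
        rw [mem_coe, inr_mem_disjSum, mem_filter]
        tauto
    · intro p hp q hq hpq
      simp only [coe_filter, Set.mem_ofPred_eq] at hp hq
      have hp1 : (p * swap o i) i = p o := by simp
      have hq1 : (q * swap o i) i = q o := by simp
      have key : ∀ {u v : Perm α}, u i ∈ A → v o ∈ B → u ≠ v * swap o i := by
        rintro u v hu hv rfl
        exact disjoint_left.1 hAB hu (by simpa using hv)
      dsimp only at hpq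
      split_ifs at hpq
      · exact Sum.inl.inj hpq
      · exact (key hp.2.1 hq.2.2 (Sum.inl.inj hpq)).elim
      · exact (key hq.2.1 hp.2.2 (Sum.inl.inj hpq).symm).elim
      · exact mul_right_cancel (Sum.inl.inj hpq)
      · exact Sum.inr.inj hpq
  have h3 : #{p ∈ M | p i ∈ A ∪ B} ≤
      ∑ a ∈ A ∪ B, classCost o P (coset P s) X Y i a := by
    rw [card_eq_sum_card_fiberwise (s := {p ∈ M | p i ∈ A ∪ B}) (f := fun p => p i) (t := A ∪ B)
      (fun p hp => (mem_filter.1 hp).2)]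
    refine sum_le_sum fun a _ => le_trans (card_le_card ?_) card_missing_le_classCost
    exact filter_subset_filter _ (filter_subset _ _)
  have h4 : #(symbols X i ∩ symbols Y i) * f ≤
      ∑ a ∈ symbols X i ∩ symbols Y i, classCost o P (coset P s) X Y i a := by
    simpa using card_nsmul_le_sum _ _ f hf
  have h5 : ∑ a ∈ symbols X i ∩ symbols Y i, classCost o P (coset P s) X Y i a +
      ∑ a ∈ A ∪ B, classCost o P (coset P s) X Y i a ≤
      ∑ a ∈ P.image s, classCost o P (coset P s) X Y i a := by
    rw [← sum_union]
    · refine sum_le_sum_of_subset (union_subset (fun a ha => ?_) (union_subset hA hB))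
      obtain ⟨x, hx, rfl⟩ := mem_image.1 (mem_inter.1 ha).1
      exact hC x (hX hx)
    · refine disjoint_left.2 fun a ha hab => ?_
      rw [mem_inter] at ha
      rcases mem_union.1 hab with h | h
      · exact disjoint_left.1 hAY h ha.2
      · exact disjoint_left.1 hBX h ha.1
  rw [cost_eq (Y := Y) hi hC hX]
  rw [← h1]
  change _ ≤ _ + ∑ a ∈ P.image s, classCost o P (coset P s) X Y i a
  omega

/-- A permutation whose symbol at `i` does not occur there in `Y`, and whose symbol at `i'` does not
occur there in `X`, lies outside `X ∪ Y`. If at least two symbols do not occur at `i'` in `X`,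
each class that `Y` does not meet holds at least `(#P - 2)!` of these permutations. -/
lemma mul_add_mul_le_cost {o i i' : α} {P : Finset α} {s : Perm α} {X Y : Finset (Perm α)}
    {f : ℕ} (hi : i ∈ P.erase o) (hi' : i' ∈ P.erase o) (hne : i' ≠ i) (hX : X ⊆ coset P s)
    (hY : Y ⊆ coset P s) (hf : ∀ a ∈ symbols Y i, f ≤ classCost o P (coset P s) X Y i a)
    (hcard : #(symbols X i') + 2 ≤ #P) :
    #(symbols Y i) * f + (#P - #(symbols Y i)) * (#P - 2).factorial ≤
      cost o P (coset P s) X Y := by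
  obtain ⟨hio, hiP⟩ := mem_erase.1 hi
  obtain ⟨hio', hiP'⟩ := mem_erase.1 hi'
  have hC : ∀ p ∈ coset P s, p i ∈ P.image s := fun p hp => apply_mem_image hp hiP
  have hC' : ∀ p ∈ coset P s, p i' ∈ P.image s := fun p hp => apply_mem_image hp hiP'
  have hT : #(P.image s) = #P := card_image_of_injective _ s.injective
  have hYT : symbols Y i ⊆ P.image s := image_subset_iff.2 fun y hy => hC y (hY hy)
  have hXT : symbols X i' ⊆ P.image s := image_subset_iff.2 fun x hx => hC' x (hX hx)
  set A := P.image s \ symbols Y i with hA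
  set B := P.image s \ symbols X i' with hB
  have hAc : #A = #P - #(symbols Y i) := by rw [hA, card_sdiff_of_subset hYT, hT]
  have hBc : 2 ≤ #B := by
    rw [hB, card_sdiff_of_subset hXT, hT]
    omega
  have h1 : #A ≤ #{q ∈ A ×ˢ B | q.2 ≠ q.1} := by
    refine card_le_card_of_surjOn (fun q => q.1) fun a ha => ?_
    obtain ⟨b, hb, hba⟩ := exists_mem_ne hBc a
    exact ⟨(a, b), by simpa [hba, hb] using ha, rfl⟩
  have h2 := card_filter_mem_mem s hiP hiP' hne (A := A) (B := B) sdiff_subset sdiff_subset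
  have h3 : #{p ∈ coset P s | p i ∈ A ∧ p i' ∈ B} ≤
      ∑ a ∈ A, classCost o P (coset P s) X Y i a := by
    rw [card_eq_sum_card_fiberwise (f := fun p : Perm α => p i) (t := A)
      (fun p hp => (mem_filter.1 hp).2.1)]
    refine sum_le_sum fun a _ => le_trans (card_le_card ?_) card_missing_le_classCost
    refine filter_subset_filter _ fun p hp => ?_
    rw [mem_filter] at hp
    refine mem_sdiff.2 ⟨hp.1, fun h => ?_⟩
    rcases mem_union.1 h with h | h
    · exact (mem_sdiff.1 hp.2.2).2 (mem_image_of_mem _ h)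
    · exact (mem_sdiff.1 hp.2.1).2 (mem_image_of_mem _ h)
  have h4 : #(symbols Y i) * f ≤ ∑ a ∈ symbols Y i, classCost o P (coset P s) X Y i a := by
    simpa using card_nsmul_le_sum _ _ f hf
  have h5 := sum_classCost_le_cost (Y := Y) hi hX (A := symbols Y i ∪ A)
    (union_subset hYT sdiff_subset)
  rw [sum_union disjoint_sdiff, ← hA] at h5
  have h6 := Nat.mul_le_mul_right (#P - 2).factorial h1
  rw [← hAc]
  omega

/-- A bound on the cost in smaller star graphs applies to every class that meets both `X` and
`Y`, since such a class is itself a coset. -/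
lemma le_classCost {o i : α} {P : Finset α} {s : Perm α} {X Y : Finset (Perm α)} {f : ℕ}
    (hX : X ⊆ coset P s) (hY : Y ⊆ coset P s)
    (ih : ∀ s' X' Y', X' ⊆ coset (P.erase i) s' → Y' ⊆ coset (P.erase i) s' → X'.Nonempty →
      Y'.Nonempty → (∃ a, X' = {x ∈ X | x i = a} ∧ Y' = {y ∈ Y | y i = a}) →
      f ≤ cost o (P.erase i) (coset (P.erase i) s') X' Y') :
    ∀ a ∈ symbols X i ∩ symbols Y i, f ≤ classCost o P (coset P s) X Y i a := by
  intro a ha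
  rw [mem_inter, mem_image, mem_image] at ha
  obtain ⟨⟨x, hx, rfl⟩, y, hy, hyx⟩ := ha
  unfold classCost
  rw [filter_coset (hX hx)]
  refine ih x _ _ ?_ ?_ ⟨x, mem_filter.2 ⟨hx, rfl⟩⟩ ⟨y, mem_filter.2 ⟨hy, hyx⟩⟩ ⟨_, rfl, rfl⟩
  · rw [← filter_coset (hX hx)]
    exact filter_subset_filter _ hX
  · rw [← filter_coset (hX hx)]
    exact filter_subset_filter _ hY

/-- The classes given by the symbol at `i`: some class meets neither side, or each side has a class
of its own, or one side meets every class that the other meets. -/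
lemma symbols_cases {o i : α} {P : Finset α} {s : Perm α} {X Y : Finset (Perm α)} {f : ℕ}
    (hi : i ∈ P.erase o) (ho : o ∈ P) (hX : X ⊆ coset P s) (hY : Y ⊆ coset P s)
    (hf : ∀ a ∈ symbols X i ∩ symbols Y i, f ≤ classCost o P (coset P s) X Y i a) :
    (#P - 1).factorial ≤ cost o P (coset P s) X Y ∨
    (∃ a b c, 0 < a ∧ 0 < b ∧ a + b + c = #P ∧
      c * f + a * b * (#P - 2).factorial ≤ cost o P (coset P s) X Y) ∨
    symbols X i ⊆ symbols Y i ∨ symbols Y i ⊆ symbols X i := by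
  have hiP := mem_of_mem_erase hi
  have hYT : symbols Y i ⊆ P.image s := image_subset_iff.2 fun y hy => apply_mem_image (hY hy) hiP
  have hXT : symbols X i ⊆ P.image s := image_subset_iff.2 fun x hx => apply_mem_image (hX hx) hiP
  by_cases hcov : P.image s ⊆ symbols X i ∪ symbols Y i
  · by_cases hA : symbols X i ⊆ symbols Y i
    · exact .inr (.inr (.inl hA))
    by_cases hB : symbols Y i ⊆ symbols X i
    · exact .inr (.inr (.inr hB))
    refine .inr (.inl ⟨#(symbols X i \ symbols Y i), #(symbols Y i \ symbols X i),
      #(symbols X i ∩ symbols Y i), ?_, ?_, ?_, ?_⟩)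
    · rwa [card_pos, sdiff_nonempty]
    · rwa [card_pos, sdiff_nonempty]
    · rw [← card_image_of_injective P s.injective, hcov.antisymm (union_subset hXT hYT),
        ← card_sdiff_add_card, ← card_sdiff_add_card_inter (symbols Y i) (symbols X i),
        inter_comm (symbols Y i)]
      ring
    · exact mul_add_le_cost hi ho hX hf (sdiff_subset.trans hXT) (sdiff_subset.trans hYT)
        sdiff_disjoint sdiff_disjoint disjoint_sdiff_sdiff
  · obtain ⟨a, ha, ha'⟩ := not_subset.1 hcov
    rw [mem_union, not_or] at ha'
    exact .inl (factorial_le_cost hi hX ha ha'.1 ha'.2)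

/-! ### The isoperimetric inequality -/

lemma card_inter_mul_le_cost {o i : α} {P : Finset α} {s : Perm α} {X Y : Finset (Perm α)}
    {f : ℕ} (hi : i ∈ P.erase o) (hX : X ⊆ coset P s)
    (hf : ∀ a ∈ symbols X i ∩ symbols Y i, f ≤ classCost o P (coset P s) X Y i a) :
    #(symbols X i ∩ symbols Y i) * f ≤ cost o P (coset P s) X Y := by
  refine le_trans ?_ (sum_classCost_le_cost (Y := Y) hi hX
    (A := symbols X i ∩ symbols Y i) (inter_subset_left.trans ?_))
  · simpa using card_nsmul_le_sum _ _ f hf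
  · exact image_subset_iff.2 fun x hx => apply_mem_image (hX hx) (mem_of_mem_erase hi)

/-- If all of `X` has the same symbol at `i`, the edges in direction `i` leave `X`, so that something
outside the only class of `X` contributes to the cost. -/
lemma classCost_lt_cost {o i a : α} {P : Finset α} {s : Perm α} {X Y : Finset (Perm α)}
    (hi : i ∈ P.erase o) (ho : o ∈ P) (hX : X ⊆ coset P s) (hne : X.Nonempty)
    (ha : symbols X i = {a}) :
    classCost o P (coset P s) X Y i a < cost o P (coset P s) X Y := by
  obtain ⟨hio, hiP⟩ := mem_erase.1 hi
  have hC : ∀ p ∈ coset P s, p i ∈ P.image s := fun p hp => apply_mem_image hp hiP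
  have hXa : ∀ x ∈ X, x i = a := fun x hx => by
    rw [← mem_singleton, ← ha]
    exact mem_image_of_mem _ hx
  obtain ⟨x, hx⟩ := hne
  have hq := mul_swap_mem_coset (hX hx) ho hiP
  have hqi : (x * swap o i) i = x o := by simp
  have hxo : x o ≠ a := by
    rw [← hXa x hx]
    exact x.injective.ne hio.symm
  have haT : a ∈ P.image s := hXa x hx ▸ hC x (hX hx)
  by_cases hY : x * swap o i ∈ Y
  · rw [cost_eq (Y := Y) hi hC hX]
    have h1 : 0 < #{x ∈ X | x * swap o i ∈ Y} := card_pos.2 ⟨x, mem_filter.2 ⟨hx, hY⟩⟩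
    have h2 := single_le_sum (f := fun a => classCost o P (coset P s) X Y i a)
      (fun _ _ => Nat.zero_le _) haT
    change _ < _ + ∑ a ∈ P.image s, classCost o P (coset P s) X Y i a
    omega
  · have h1 := sum_classCost_le_cost (Y := Y) hi hX (A := {x o, a})
      (insert_subset (by rw [← hqi]; exact hC _ hq) (singleton_subset_iff.2 haT))
    rw [sum_pair hxo] at h1
    have h2 : 0 < #{p ∈ coset P s \ (X ∪ Y) | p i = x o} := by
      refine card_pos.2 ⟨x * swap o i, mem_filter.2 ⟨mem_sdiff.2 ⟨hq, fun h => ?_⟩, hqi⟩⟩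
      rcases mem_union.1 h with h | h
      · exact hxo (by rw [← hqi, hXa _ h])
      · exact hY h
    have h3 := card_missing_le_classCost (o := o) (P := P) (C := coset P s) (X := X) (Y := Y)
      (i := i) (a := x o)
    omega

lemma classCost_comm {o i a : α} {P : Finset α} {C X Y : Finset (Perm α)} :
    classCost o P C X Y i a = classCost o P C Y X i a := cost_comm ..

/-- The case without a degree condition: the star graph of dimension `m` has (vertex and edge)
connectivity at least `m - 1`. -/
lemma card_sub_one_le_cost {o : α} (P : Finset α) : ∀ {s : Perm α} {X Y : Finset (Perm α)},
    o ∈ P → X ⊆ coset P s → Y ⊆ coset P s → X.Nonempty → Y.Nonempty → Disjoint X Y →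
      #P - 1 ≤ cost o P (coset P s) X Y := by
  induction P using Finset.strongInduction with
  | H P ih =>
  intro s X Y ho hX hY hXne hYne hd
  rcases Nat.lt_or_ge (#P) 2 with hP | hP
  · omega
  obtain ⟨i, hiP, hio⟩ := exists_mem_ne hP o
  have hi : i ∈ P.erase o := mem_erase.2 ⟨hio, hiP⟩
  have hf := le_classCost (o := o) (i := i) (f := #P - 2) hX hY (by
    rintro s' X' Y' hX' hY' hXn hYn ⟨a, rfl, rfl⟩
    have := ih (P.erase i) (erase_ssubset hiP) (mem_erase.2 ⟨hio.symm, ho⟩) hX' hY' hXn hYn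
      (disjoint_filter_filter hd)
    rw [card_erase_of_mem hiP] at this
    omega)
  -- A side with all its symbols at `i` common to both, fewer than two of them, has just one.
  have side : ∀ {X Y : Finset (Perm α)}, X ⊆ coset P s → X.Nonempty →
      (∀ a ∈ symbols X i ∩ symbols Y i, #P - 2 ≤ classCost o P (coset P s) X Y i a) →
      symbols X i ⊆ symbols Y i → #(symbols X i ∩ symbols Y i) < 2 →
      #P - 1 ≤ cost o P (coset P s) X Y := by
    intro X Y hX hXne hf hsub hlt
    rw [inter_eq_left.2 hsub] at hf hlt
    obtain ⟨a, ha⟩ := card_eq_one.1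
      (show #(symbols X i) = 1 by
        have : 0 < #(symbols X i) := (hXne.image _).card_pos
        omega)
    have h1 := classCost_lt_cost (Y := Y) hi ho hX hXne ha
    have h2 := hf a (by simp [ha])
    omega
  rcases Nat.lt_or_ge (#(symbols X i ∩ symbols Y i)) 2 with hc | hc
  · rcases symbols_cases hi ho hX hY hf with h | ⟨a, b, c, ha, hb, habc, h⟩ | h | h
    · exact (Nat.self_le_factorial _).trans h
    · refine le_trans ?_ h
      have h1 := Nat.mul_le_mul_left (a * b) (Nat.factorial_pos (#P - 2))
      have h2 : 1 ≤ a * b := Nat.mul_pos ha hb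
      rcases Nat.eq_zero_or_pos c with rfl | hc
      · have h3 : a + b ≤ a * b + 1 := by nlinarith
        omega
      · have h3 := Nat.mul_le_mul_right (#P - 2) hc
        omega
    · exact side hX hXne hf h hc
    · rw [cost_comm]
      refine side hY hYne (fun a ha => ?_) h (by rwa [inter_comm])
      rw [classCost_comm]
      exact hf a (by rwa [inter_comm])
  · refine le_trans ?_ (card_inter_mul_le_cost hi hX hf)
    have h1 := Nat.mul_le_mul_right (#P - 2) hc
    -- A common class has two elements, so it is not the class of a two-element `P`.
    obtain ⟨a, ha⟩ := card_pos.1 (show 0 < #(symbols X i ∩ symbols Y i) by omega)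
    obtain ⟨hax, hay⟩ := mem_inter.1 ha
    obtain ⟨x, hx, rfl⟩ := mem_image.1 hax
    obtain ⟨y, hy, hyx⟩ := mem_image.1 hay
    have h2 : 1 < #{p ∈ coset P s | p i = x i} :=
      one_lt_card.2 ⟨x, by simp [hX hx], y, by simp [hY hy, hyx], disjoint_iff_ne.1 hd x hx y hy⟩
    rw [card_filter_apply s hiP (apply_mem_image (hX hx) hiP)] at h2
    have h3 : #P ≠ 2 := by
      intro h
      simp [h] at h2
    omega

lemma factorial_mul_le (k r : ℕ) : (k + 1).factorial * r ≤ (k + r).factorial := by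
  rcases r with _ | t
  · simp
  · have h1 := Nat.factorial_mul_pow_le_factorial (m := k + 1) (n := t)
    have h2 : t + 1 ≤ (k + 1 + 1) ^ t :=
      (Nat.lt_two_pow_self).trans_le (Nat.pow_le_pow_left (by omega) t)
    rw [show k + (t + 1) = k + 1 + t by ring]
    exact (Nat.mul_le_mul_left _ h2).trans h1

/-- Separating two sets of minimum degree at least `k` in a star graph of dimension `#P`, by deleting
vertices and edges, costs at least `(k + 1)! (#P - k - 1)`. -/
theorem factorial_mul_le_cost {o : α} (k : ℕ) : ∀ {P : Finset α} {s : Perm α}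
    {X Y : Finset (Perm α)}, o ∈ P → X ⊆ coset P s → Y ⊆ coset P s → X.Nonempty → Y.Nonempty →
      Disjoint X Y → MinDegree o P k X → MinDegree o P k Y →
      (k + 1).factorial * (#P - k - 1) ≤ cost o P (coset P s) X Y := by
  induction k with
  | zero =>
    intro P s X Y ho hX hY hXne hYne hd _ _
    simpa using card_sub_one_le_cost P ho hX hY hXne hYne hd
  | succ k ih =>
  intro P s X Y ho hX hY hXne hYne hd hXk hYk
  -- For `r = 0` the bound is trivial.
  obtain ⟨r, hr⟩ : ∃ r, #P - (k + 1) - 1 = r := ⟨_, rfl⟩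
  rw [hr, Nat.factorial_succ, mul_assoc]
  rcases Nat.eq_zero_or_pos r with rfl | hr0
  · simp
  have hP : #P = k + 2 + r := by omega
  set f := (k + 1).factorial * r
  have hfle : f ≤ (#P - 2).factorial := by
    rw [hP, show k + 2 + r - 2 = k + r by omega]
    exact factorial_mul_le k r
  have hf : ∀ i ∈ P.erase o,
      ∀ a ∈ symbols X i ∩ symbols Y i, f ≤ classCost o P (coset P s) X Y i a := by
    intro i hi
    obtain ⟨hio, hiP⟩ := mem_erase.1 hi
    refine le_classCost hX hY ?_
    rintro s' X' Y' hX' hY' hXn hYn ⟨a, rfl, rfl⟩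
    have := ih (P := P.erase i) (mem_erase.2 ⟨hio.symm, ho⟩) hX' hY' hXn hYn
      (disjoint_filter_filter hd) (hXk.filter hio a) (hYk.filter hio a)
    rwa [card_erase_of_mem hiP, show #P - 1 - k - 1 = r by omega] at this
  by_contra! hlt
  -- If the cost is too small, then at every position there are few common symbols and one side has
  -- no others.
  have main : ∀ i ∈ P.erase o, #(symbols X i ∩ symbols Y i) < k + 2 ∧
      (symbols X i ⊆ symbols Y i ∨ symbols Y i ⊆ symbols X i) := by
    intro i hi
    constructor
    · by_contra! hc
      exact hlt.not_ge ((Nat.mul_le_mul_right f hc).trans (card_inter_mul_le_cost hi hX (hf i hi)))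
    rcases symbols_cases hi ho hX hY (hf i hi) with
      h | ⟨a, b, c, ha, hb, habc, h⟩ | h | h
    · refine (hlt.not_ge (le_trans ?_ h)).elim
      rw [show #P - 1 = #P - 2 + 1 by omega, Nat.factorial_succ]
      exact Nat.mul_le_mul (by omega) hfle
    · refine (hlt.not_ge (le_trans ?_ h)).elim
      have h1 : k + 2 ≤ c + a * b := by
        have : a + b ≤ a * b + 1 := by nlinarith
        omega
      calc (k + 1 + 1) * f ≤ (c + a * b) * f := Nat.mul_le_mul_right f h1
        _ = c * f + a * b * f := by ring
        _ ≤ _ := by gcongr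
    · exact .inl h
    · exact .inr h
  -- A position where `X` has many symbols, and one where `Y` has: the other side has few there.
  obtain ⟨i, hi, hXi⟩ := exists_card_image P ho hX hXne hXk
  obtain ⟨i', hi', hYi⟩ := exists_card_image P ho hY hYne hYk
  obtain ⟨h1, h2⟩ := main i hi
  obtain ⟨h1', h2'⟩ := main i' hi'
  have h3 : symbols Y i ⊆ symbols X i := h2.resolve_left fun h => by
    rw [inter_eq_left.2 h] at h1
    exact absurd hXi (by omega)
  have h3' : symbols X i' ⊆ symbols Y i' := h2'.resolve_right fun h => by
    rw [inter_eq_right.2 h] at h1'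
    exact absurd hYi (by omega)
  rw [inter_eq_right.2 h3] at h1
  rw [inter_eq_left.2 h3'] at h1'
  have hne : i' ≠ i := by
    rintro rfl
    exact absurd hXi (by omega)
  have h4 := mul_add_mul_le_cost hi hi' hne hX hY
    (fun a ha => hf i hi a (mem_inter.2 ⟨h3 ha, ha⟩)) (by omega)
  refine hlt.not_ge (le_trans ?_ h4)
  calc (k + 1 + 1) * f ≤ (#(symbols Y i) + (#P - #(symbols Y i))) * f :=
        Nat.mul_le_mul_right f (by omega)
    _ = #(symbols Y i) * f + (#P - #(symbols Y i)) * f := by ring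
    _ ≤ _ := by gcongr

/-! ### Cuts of the star graph: lower bounds -/

variable {n k : ℕ}

lemma starGraph_adj {o : Fin n} (ho : o.val = 0) {p q : Perm (Fin n)} :
    (starGraph n).Adj p q ↔ ∃ j, j ≠ o ∧ q = p * swap o j := by
  constructor
  · rintro ⟨i, j, hi, hj, rfl⟩
    obtain rfl : i = o := Fin.ext (hi.trans ho.symm)
    exact ⟨j, hj, rfl⟩
  · rintro ⟨j, hj, rfl⟩
    exact ⟨o, j, ho, hj, rfl⟩

lemma coset_univ {α : Type*} [Fintype α] [DecidableEq α] (s : Perm α) :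
    coset univ s = univ := by
  ext p
  simp [mem_coset]

/-- A disconnected subgraph of the star graph, given by an embedding `e` of its vertices, splits into
two sides whose separation has the cost bounded in `factorial_mul_le_cost`. One side is a connected
component and the other consists of the remaining vertices. -/
lemma exists_sides {W : Type*} {_ : Fintype W} {H : SimpleGraph W} {_ : DecidableRel H.Adj}
    {o : Fin n} (ho : o.val = 0) (e : W ↪ Perm (Fin n))
    (hadj : ∀ a b, H.Adj a b → (starGraph n).Adj (e a) (e b)) (hH : ¬ H.Preconnected)
    (hk : k ≤ H.minDegree) :
    ∃ X Y : Finset (Perm (Fin n)), Disjoint X Y ∧ (∀ p, p ∈ X ∪ Y ↔ p ∈ Set.range e) ∧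
      (∀ a b, e a ∈ X → e b ∈ Y → ¬ H.Adj a b) ∧
      (k + 1).factorial * (n - k - 1) ≤ cost o univ univ X Y := by
  classical
  unfold SimpleGraph.Preconnected at hH
  push Not at hH
  obtain ⟨u, v, huv⟩ := hH
  have deg : ∀ R : Finset W, (∀ a b, H.Adj a b → a ∈ R → b ∈ R) →
      MinDegree o univ k (R.map e) := by
    intro R hR x hx
    obtain ⟨a, ha, rfl⟩ := mem_map.1 hx
    refine (hk.trans (H.minDegree_le_degree a)).trans ?_
    rw [← SimpleGraph.card_neighborFinset_eq_degree]
    refine card_le_card_of_injOn (fun b => (e a).symm (e b o)) ?_ ?_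
    · intro b hb
      rw [mem_coe, SimpleGraph.mem_neighborFinset] at hb
      obtain ⟨j, hj, hq⟩ := (starGraph_adj ho).1 (hadj a b hb)
      have h1 : e b ∈ R.map e := mem_map_of_mem e (hR a b hb ha)
      rw [hq] at h1
      simp only [hq, Perm.mul_apply, swap_apply_left, symm_apply_apply, coe_filter, mem_erase,
        Set.mem_ofPred_eq]
      exact ⟨⟨hj, mem_univ _⟩, h1⟩
    · intro b hb c hc hbc
      rw [mem_coe, SimpleGraph.mem_neighborFinset] at hb hc
      obtain ⟨j, hj, hq⟩ := (starGraph_adj ho).1 (hadj a b hb)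
      obtain ⟨j', hj', hq'⟩ := (starGraph_adj ho).1 (hadj a c hc)
      have : j = j' := by simpa [hq, hq'] using hbc
      exact e.injective (by rw [hq, hq', this])
  obtain ⟨R, hR⟩ : ∃ R : Finset W, ∀ a, a ∈ R ↔ H.Reachable u a :=
    ⟨@filter W (H.Reachable u) (Classical.decPred _) univ, fun a => by simp⟩
  have hd : Disjoint (R.map e) (Rᶜ.map e) := by
    rw [disjoint_map]
    exact disjoint_compl_right
  refine ⟨R.map e, Rᶜ.map e, hd, ?_, ?_, ?_⟩
  · intro p
    rw [← map_union, union_compl]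
    simp
  · intro a b ha hb hab
    rw [mem_map' e] at ha hb
    rw [mem_compl] at hb
    exact hb ((hR b).2 (((hR a).1 ha).trans hab.reachable))
  · have h := factorial_mul_le_cost (o := o) k (P := univ) (s := 1) (mem_univ o)
      (by simp [coset_univ]) (by simp [coset_univ])
      ⟨e u, mem_map_of_mem e ((hR u).2 (.refl u))⟩
      ⟨e v, mem_map_of_mem e (mem_compl.2 fun h => huv ((hR v).1 h))⟩ hd
      (deg R fun a b hab ha => (hR b).2 (((hR a).1 ha).trans hab.reachable))
      (deg Rᶜ fun a b hab ha => mem_compl.2 fun hb =>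
        mem_compl.1 ha ((hR a).2 (((hR b).1 hb).trans hab.symm.reachable)))
    rwa [coset_univ, card_univ, Fintype.card_fin] at h

lemma le_card_of_isKVertexCut {o : Fin n} (ho : o.val = 0) {S : Finset (Perm (Fin n))}
    (hS : IsKVertexCut (starGraph n) k S) : (k + 1).factorial * (n - k - 1) ≤ #S := by
  classical
  obtain ⟨X, Y, hd, hXY, hno, h⟩ := exists_sides ho (Function.Embedding.subtype _)
    (fun a b hab => hab) hS.1 hS.2
  have mem : ∀ p, p ∈ X ∪ Y ↔ p ∉ S := by
    intro p
    rw [hXY]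
    exact ⟨fun ⟨a, ha⟩ => ha ▸ a.2, fun h => ⟨⟨p, h⟩, rfl⟩⟩
  refine h.trans ?_
  unfold cost
  rw [filter_false_of_mem, card_empty, add_zero]
  · refine card_le_card fun p hp => ?_
    rw [mem_sdiff, mem] at hp
    exact not_not.1 hp.2
  · rintro ⟨x, j⟩ hq hY
    rw [mem_product, mem_erase] at hq
    exact hno ⟨x, (mem x).1 (mem_union_left _ hq.1)⟩
      ⟨x * swap o j, (mem _).1 (mem_union_right _ hY)⟩ hq.1 hY
      ((starGraph_adj ho).2 ⟨j, hq.2.1, rfl⟩)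

lemma le_card_of_isKEdgeCut {o : Fin n} (ho : o.val = 0) {F : Finset (Sym2 (Perm (Fin n)))}
    (hF : IsKEdgeCut (starGraph n) k F) : (k + 1).factorial * (n - k - 1) ≤ #F := by
  classical
  obtain ⟨X, Y, hd, hXY, hno, h⟩ := exists_sides ho (Function.Embedding.refl _)
    (fun a b hab => (SimpleGraph.deleteEdges_le _ hab)) hF.2.1 hF.2.2
  have huniv : X ∪ Y = univ := eq_univ_of_forall fun p => (hXY p).2 ⟨p, rfl⟩
  refine h.trans ?_
  unfold cost
  rw [huniv, sdiff_self, bot_eq_empty, card_empty, zero_add]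
  refine card_le_card_of_injOn (fun q => s(q.1, q.1 * swap o q.2)) ?_ ?_
  · rintro ⟨x, j⟩ hq
    simp only [coe_filter, mem_product, Set.mem_ofPred_eq, mem_erase] at hq
    by_contra hn
    refine hno x _ hq.1.1 hq.2 ?_
    rw [SimpleGraph.deleteEdges_adj]
    exact ⟨(starGraph_adj ho).2 ⟨j, hq.1.2.1, rfl⟩, hn⟩
  · rintro ⟨x, j⟩ hq ⟨y, l⟩ hr hqr
    simp only [coe_filter, mem_product, Set.mem_ofPred_eq] at hq hr
    rcases Sym2.eq_iff.1 hqr with ⟨rfl, h2⟩ | ⟨h1, -⟩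
    · have h3 := congrArg (fun p : Perm (Fin n) => p o) (mul_left_cancel h2)
      simp only [swap_apply_left] at h3
      rw [h3]
    · exact (disjoint_left.1 hd hq.1.1 (by rw [show x = y * swap o l from h1]; exact hr.2)).elim

/-! ### Cuts of the star graph: minimum cuts -/

lemma not_reachable_of_closed {W : Type*} {H : SimpleGraph W} {p : W → Prop}
    (hp : ∀ a b, H.Adj a b → p a → p b) {u v : W} (hu : p u) (hv : ¬ p v) :
    ¬ H.Reachable u v := by
  rintro ⟨w⟩
  induction w with
  | nil => exact hv hu
  | cons h _ ih => exact ih (hp _ _ h hu) hv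

/-- The permutations that fix all positions `i > k`. They span a star graph of dimension `k + 1`,
whose neighbourhood and whose edge boundary are minimum cuts. -/
def subStar (n k : ℕ) : Finset (Perm (Fin n)) := coset {i | i.val ≤ k} 1

lemma mem_subStar {p : Perm (Fin n)} : p ∈ subStar n k ↔ ∀ i, k < i.val → p i = i := by
  simp [subStar, mem_coset]

lemma card_subStar_product (hk : k < n) :
    #(subStar n k ×ˢ ({i | k < i.val} : Finset (Fin n))) =
      (k + 1).factorial * (n - k - 1) := by
  have h1 : #({i | i.val ≤ k} : Finset (Fin n)) = k + 1 := by
    have : ({i | i.val ≤ k} : Finset (Fin n)) = Iic ⟨k, hk⟩ := by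
      ext i
      simp [Fin.le_def]
    rw [this, Fin.card_Iic]
  have h2 := card_filter_add_card_filter_not (s := (univ : Finset (Fin n))) (fun i => i.val ≤ k)
  rw [h1, card_univ, Fintype.card_fin] at h2
  simp only [not_le] at h2
  rw [card_product, subStar, card_coset, h1]
  congr 1
  omega

lemma mul_swap_mem_subStar {o j : Fin n} (ho : o.val = 0) {p : Perm (Fin n)}
    (hp : p ∈ subStar n k) (hj : j.val ≤ k) : p * swap o j ∈ subStar n k :=
  mul_swap_mem_coset hp (by simp [ho]) (by simpa using hj)

lemma mul_swap_notMem_subStar {o j : Fin n} (ho : o.val = 0) {p : Perm (Fin n)}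
    (hp : p ∈ subStar n k) (hj : k < j.val) : p * swap o j ∉ subStar n k := by
  intro h
  rw [mem_subStar] at h hp
  have h1 := h j hj
  have h2 := hp j hj
  rw [Perm.mul_apply, swap_apply_right] at h1
  have := p.injective (h1.trans h2.symm)
  simp [← this, ho] at hj

lemma le_card_subStar_directions {o : Fin n} (ho : o.val = 0) (hk : k < n) {T : Finset (Fin n)}
    (hT : ∀ j ≠ o, j.val ≤ k → j ∈ T) : k ≤ #T := by
  have h1 : (Icc 1 k).attach.card = k := by simp
  have h2 : ∀ j ∈ Icc 1 k, j < n := fun j hj => by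
    rw [mem_Icc] at hj
    omega
  rw [← h1]
  refine card_le_card_of_injOn (fun j => ⟨j.1, h2 j.1 j.2⟩) ?_ ?_
  · intro j _
    have := mem_Icc.1 j.2
    refine hT _ ?_ this.2
    rw [Ne, Fin.ext_iff, ho]
    dsimp only
    omega
  · intro a _ b _ hab
    exact Subtype.ext (by simpa using hab)

/-- If at most one of the `n - 1` directions is missing from `T`, then `T` has at least
`n - 2 ≥ k` elements. -/
lemma le_card_of_subsingleton {o : Fin n} (hk : k + 2 ≤ n) {T : Finset (Fin n)}
    (hT : ∀ i ≠ o, ∀ j ≠ o, i ∉ T → j ∉ T → i = j) : k ≤ #T := by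
  have h1 : #((univ \ T).erase o) ≤ 1 := by
    refine card_le_one.2 fun i hi j hj => ?_
    simp only [mem_erase, mem_sdiff, mem_univ, true_and] at hi hj
    exact hT i hi.1 j hj.1 hi.2 hj.2
  have h2 := pred_card_le_card_erase (s := univ \ T) (a := o)
  rw [card_sdiff_of_subset (subset_univ _), card_univ, Fintype.card_fin] at h2
  omega

lemma le_minDegree {W : Type*} {_ : Fintype W} {H : SimpleGraph W} {_ : DecidableRel H.Adj}
    [Nonempty W] {o : Fin n} (e : W → Perm (Fin n))
    (h : ∀ a, ∃ T : Finset (Fin n), k ≤ #T ∧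
      ∀ j ∈ T, ∃ b, H.Adj a b ∧ e b = e a * swap o j) : k ≤ H.minDegree := by
  refine H.le_minDegree_of_forall_le_degree _ fun a => ?_
  obtain ⟨T, hk, hT⟩ := h a
  refine hk.trans ?_
  rw [← SimpleGraph.card_neighborFinset_eq_degree]
  refine card_le_card_of_surjOn (fun b => (e a).symm (e b o)) fun j hj => ?_
  obtain ⟨b, hb, hbe⟩ := hT j hj
  exact ⟨b, by simpa using hb, by simp [hbe]⟩

lemma exists_isKVertexCut {o : Fin n} (ho : o.val = 0) (hk : k + 2 ≤ n) (hn : 3 ≤ n) :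
    ∃ S, IsKVertexCut (starGraph n) k S ∧ #S ≤ (k + 1).factorial * (n - k - 1) := by
  classical
  set S := (subStar n k ×ˢ ({i | k < i.val} : Finset (Fin n))).image
    fun q => q.1 * swap o q.2 with hS
  have memS : ∀ p, p ∈ S ↔ ∃ x ∈ subStar n k, ∃ i : Fin n, k < i.val ∧ x * swap o i = p := by
    intro p
    simp only [hS, mem_image, mem_product, mem_filter, mem_univ, true_and, Prod.exists]
    constructor
    · rintro ⟨x, i, ⟨hx, hi⟩, h⟩
      exact ⟨x, hx, i, hi, h⟩
    · rintro ⟨x, hx, i, hi, h⟩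
      exact ⟨x, i, ⟨hx, hi⟩, h⟩
  have hdisj : ∀ p ∈ subStar n k, p ∉ S := by
    intro p hp h
    obtain ⟨x, hx, i, hi, rfl⟩ := (memS p).1 h
    exact mul_swap_notMem_subStar ho hx hi hp
  -- The symbol in the first position of an element of `S` tells which position is not fixed.
  have hSo : ∀ p ∈ S, k < (p o).val ∧ ∀ i, k < i.val → i ≠ p o → p i = i := by
    intro p h
    obtain ⟨x, hx, i, hi, rfl⟩ := (memS p).1 h
    rw [mem_subStar] at hx
    have h1 : (x * swap o i) o = i := by simp [hx i hi]
    rw [h1]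
    refine ⟨hi, fun l hl hli => ?_⟩
    have hlo : l ≠ o := by
      rintro rfl
      omega
    rw [mul_swap_apply_of_ne x hlo hli.symm, hx l hl]
  refine ⟨S, ⟨?_, ?_⟩, card_image_le.trans_eq (card_subStar_product (by omega))⟩
  · have h1 : (1 : Perm (Fin n)) ∈ subStar n k := by simp [mem_subStar]
    -- The transposition of positions `1` and `n - 1` lies in neither `subStar n k` nor `S`; it needs
    -- `n ≥ 3`.
    set l : Fin n := ⟨n - 1, by omega⟩
    set m : Fin n := ⟨1, by omega⟩
    have hlm : l ≠ m := by
      simp only [l, m, Ne, Fin.mk.injEq]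
      omega
    have hol : o ≠ l := by
      rw [Ne, Fin.ext_iff, ho]
      simp only [l]
      omega
    have hom : o ≠ m := by
      rw [Ne, Fin.ext_iff, ho]
      simp only [m]
      omega
    have h2 : swap m l ∉ subStar n k := by
      rw [mem_subStar]
      intro h
      have := h l (by simp only [l]; omega)
      rw [swap_apply_right] at this
      exact hlm this.symm
    have h3 : swap m l ∉ S := fun h => by
      have := (hSo _ h).1
      rw [swap_apply_of_ne_of_ne hom hol, ho] at this
      omega
    intro hcon
    refine not_reachable_of_closed
      (p := fun a : {p // p ∈ ((S : Set (Perm (Fin n)))ᶜ)} => a.1 ∈ subStar n k) ?_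
      (u := ⟨1, hdisj 1 h1⟩) (v := ⟨swap m l, h3⟩) h1 h2 (hcon _ _)
    rintro ⟨a, ha⟩ ⟨b, hb⟩ hab hak
    obtain ⟨j, hj, rfl⟩ := (starGraph_adj ho).1 hab
    refine mul_swap_mem_subStar ho hak ?_
    by_contra! hjk
    exact hb ((memS _).2 ⟨a, hak, j, hjk, rfl⟩)
  · have : Nonempty ((S : Set (Perm (Fin n)))ᶜ : Set _) :=
      ⟨⟨1, hdisj 1 (by simp [mem_subStar])⟩⟩
    refine le_minDegree (o := o) (fun a => a.1) fun ⟨y, hy⟩ =>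
      ⟨({j | j ≠ o ∧ y * swap o j ∉ S} : Finset (Fin n)), ?_, ?_⟩
    · -- Inside, the directions `j ≤ k` survive. Outside, a vertex has at most one neighbour in `S`.
      by_cases hyk : y ∈ subStar n k
      · refine le_card_subStar_directions ho (by omega) fun j hj hjk => ?_
        simp only [mem_filter, mem_univ, true_and]
        exact ⟨hj, hdisj _ (mul_swap_mem_subStar ho hyk hjk)⟩
      · refine le_card_of_subsingleton (o := o) hk fun i hi j hj hiT hjT => ?_
        simp only [mem_filter, mem_univ, true_and, not_and, not_not] at hiT hjT
        by_contra hij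
        obtain ⟨hi1, hi2⟩ := hSo _ (hiT hi)
        obtain ⟨hj1, hj2⟩ := hSo _ (hjT hj)
        have hio : (y * swap o i) o = y i := by simp
        have hjo : (y * swap o j) o = y j := by simp
        rw [hio] at hi1 hi2
        rw [hjo] at hj1 hj2
        have hne : y j ≠ y i := y.injective.ne (Ne.symm hij)
        -- Both neighbours fix the symbol that the other one has in the first position.
        have hyj := hi2 _ hj1 hne
        have hyi := hj2 _ hi1 hne.symm
        have hji : j = y j := by
          have h1 : (y * swap o i) j = y j := mul_swap_apply_of_ne y hj (Ne.symm hij).symm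
          exact (y * swap o i).injective (h1.trans hyj.symm)
        have hii : i = y i := by
          have h1 : (y * swap o j) i = y i := mul_swap_apply_of_ne y hi (Ne.symm hij)
          exact (y * swap o j).injective (h1.trans hyi.symm)
        refine hyk (mem_subStar.2 fun l hl => ?_)
        by_cases hli : l = i
        · rw [hli]
          exact hii.symm
        have hlo : l ≠ o := by
          rintro rfl
          omega
        have := hi2 l hl (by rwa [← hii])
        rwa [mul_swap_apply_of_ne y hlo (Ne.symm hli)] at this
    · intro j hj
      simp only [mem_filter, mem_univ, true_and] at hj
      exact ⟨⟨y * swap o j, hj.2⟩, (starGraph_adj ho).2 ⟨j, hj.1, rfl⟩, rfl⟩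

lemma exists_isKEdgeCut {o : Fin n} (ho : o.val = 0) (hk : k + 2 ≤ n) :
    ∃ F, IsKEdgeCut (starGraph n) k F ∧ #F ≤ (k + 1).factorial * (n - k - 1) := by
  classical
  set F := (subStar n k ×ˢ ({i | k < i.val} : Finset (Fin n))).image
    fun q => s(q.1, q.1 * swap o q.2) with hF
  have memF : ∀ e, e ∈ F ↔ ∃ x ∈ subStar n k, ∃ i : Fin n, k < i.val ∧ s(x, x * swap o i) = e := by
    intro p
    simp only [hF, mem_image, mem_product, mem_filter, mem_univ, true_and, Prod.exists]
    constructor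
    · rintro ⟨x, i, ⟨hx, hi⟩, h⟩
      exact ⟨x, hx, i, hi, h⟩
    · rintro ⟨x, hx, i, hi, h⟩
      exact ⟨x, i, ⟨hx, hi⟩, h⟩
  have ne_o : ∀ i : Fin n, k < i.val → i ≠ o := by
    rintro i hi rfl
    omega
  -- Every edge of `F` has one end inside and one end outside.
  have hFin : ∀ x y, s(x, y) ∈ F → (x ∈ subStar n k ↔ y ∉ subStar n k) := by
    intro x y h
    obtain ⟨z, hz, i, hi, h⟩ := (memF _).1 h
    have hzi := mul_swap_notMem_subStar ho hz hi
    rcases Sym2.eq_iff.1 h with ⟨rfl, rfl⟩ | ⟨rfl, rfl⟩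
    · simp [hz, hzi]
    · simp [hz, hzi]
  have h1 : (1 : Perm (Fin n)) ∈ subStar n k := by simp [mem_subStar]
  refine ⟨F, ⟨?_, ?_, ?_⟩, card_image_le.trans_eq (card_subStar_product (by omega))⟩
  · intro e he
    obtain ⟨x, -, i, hi, rfl⟩ := (memF e).1 he
    exact (starGraph_adj ho).2 ⟨i, ne_o i hi, rfl⟩
  · intro hcon
    refine not_reachable_of_closed (p := fun a => a ∈ subStar n k) ?_ (u := 1) h1
      (mul_swap_notMem_subStar (j := ⟨n - 1, by omega⟩) ho h1 (by dsimp only; omega)) (hcon _ _)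
    intro a b hab hak
    rw [SimpleGraph.deleteEdges_adj] at hab
    obtain ⟨j, hj, rfl⟩ := (starGraph_adj ho).1 hab.1
    refine mul_swap_mem_subStar ho hak ?_
    by_contra! hjk
    exact hab.2 ((memF _).2 ⟨a, hak, j, hjk, rfl⟩)
  · refine le_minDegree (o := o) id fun y =>
      ⟨({j | j ≠ o ∧ s(y, y * swap o j) ∉ F} : Finset (Fin n)), ?_, ?_⟩
    · -- Inside, the directions `j ≤ k` survive. Outside, a vertex lies on at most one edge of `F`.
      by_cases hyk : y ∈ subStar n k
      · refine le_card_subStar_directions ho (by omega) fun j hj hjk => ?_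
        simp only [mem_filter, mem_univ, true_and]
        exact ⟨hj, fun h => (hFin _ _ h).1 hyk (mul_swap_mem_subStar ho hyk hjk)⟩
      · refine le_card_of_subsingleton (o := o) hk fun i hi j hj hiT hjT => ?_
        simp only [mem_filter, mem_univ, true_and, not_and, not_not] at hiT hjT
        have hin : ∀ l, s(y, y * swap o l) ∈ F → y * swap o l ∈ subStar n k ∧ k < l.val := by
          intro l h
          have h1 : y * swap o l ∈ subStar n k :=
            not_not.1 fun hn => hyk ((hFin _ _ h).2 hn)
          refine ⟨h1, ?_⟩
          by_contra! hl
          have := mul_swap_mem_subStar ho h1 hl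
          rw [mul_assoc, swap_mul_self, mul_one] at this
          exact hyk this
        obtain ⟨hi1, hi2⟩ := hin i (hiT hi)
        obtain ⟨hj1, hj2⟩ := hin j (hjT hj)
        rw [mem_subStar] at hi1 hj1
        -- A neighbour `y * swap o i` that fixes `i` shows that `i` is the first symbol of `y`.
        have h2 := hi1 i hi2
        have h3 := hj1 j hj2
        rw [Perm.mul_apply, swap_apply_right] at h2 h3
        exact h2.symm.trans h3
    · intro j hj
      simp only [mem_filter, mem_univ, true_and] at hj
      refine ⟨y * swap o j, ?_, rfl⟩
      rw [SimpleGraph.deleteEdges_adj]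
      exact ⟨(starGraph_adj ho).2 ⟨j, hj.1, rfl⟩, hj.2⟩

lemma starGraph_ne_top (hn : 3 ≤ n) : starGraph n ≠ ⊤ := by
  intro h
  have h1 : (starGraph n).Adj 1 (swap ⟨1, by omega⟩ ⟨2, by omega⟩) := by
    rw [h, SimpleGraph.top_adj, Ne, eq_comm, swap_eq_one_iff]
    simp
  obtain ⟨j, hj, hq⟩ := (starGraph_adj (o := ⟨0, by omega⟩) rfl).1 h1
  have h2 := congrArg (fun p : Perm (Fin n) => p ⟨0, by omega⟩) hq
  rw [one_mul] at h2
  simp only [swap_apply_left] at h2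
  rw [swap_apply_of_ne_of_ne (by simp) (by simp)] at h2
  exact hj h2.symm

lemma starGraph_two : starGraph 2 = ⊤ := by
  ext p q
  rw [SimpleGraph.top_adj, starGraph_adj (o := 0) rfl]
  revert p q
  decide

end StarCut

theorem theorem3p3 (n k : ℕ) (hk : k + 2 ≤ n) :
    superConnectivity (starGraph n) k = (((k + 1).factorial * (n - k - 1) : ℕ) : ℕ∞) ∧
      superEdgeConnectivity (starGraph n) k = (((k + 1).factorial * (n - k - 1) : ℕ) : ℕ∞) := by
  have ho : (⟨0, by omega⟩ : Fin n).val = 0 := rfl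
  constructor
  · unfold superConnectivity
    split_ifs with h
    · obtain ⟨rfl, htop⟩ := h
      obtain rfl : n = 2 := by
        by_contra hn
        exact StarCut.starGraph_ne_top (by omega) htop
      simp [Fintype.card_perm]
    · have hn : 3 ≤ n := by
        by_contra hn
        obtain rfl : n = 2 := by omega
        exact h ⟨by omega, StarCut.starGraph_two⟩
      refine le_antisymm ?_ (le_iInf₂ fun S hS => ?_)
      · obtain ⟨S, hS, hcard⟩ := StarCut.exists_isKVertexCut ho hk hn
        exact (iInf₂_le S hS).trans (Nat.cast_le.2 hcard)
      · exact Nat.cast_le.2 (StarCut.le_card_of_isKVertexCut ho hS)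
  · refine le_antisymm ?_ (le_iInf₂ fun F hF => ?_)
    · obtain ⟨F, hF, hcard⟩ := StarCut.exists_isKEdgeCut ho hk
      exact (iInf₂_le F hF).trans (Nat.cast_le.2 hcard)
    · exact Nat.cast_le.2 (StarCut.le_card_of_isKEdgeCut ho hF)
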